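/- A path-length sequence with $n\ge 1$ components is a sequence $l=(l_1,\dots,l_n)$ of non-negative integers with $l_1\le\dots\le l_n$ and $\sum_{i=1}^n 2^{-l_i}=1$. On the finite set of path-length sequences with $n$ components, let $l\trianglelefteq h$ mean that $\sum_{i=1}^m 2^{-l_i}\le\sum_{i=1}^m 2^{-h_i}$ for every $1\le m\le n$; this is a partial order (the imbalance order, which is a lattice). A path-length sequence is join-irreducible if it covers exactly one element in this order. An index $1<j<n$ is an excess index of $l$ if $l_{j-1}<l_j=l_{j+1}$ and there is an index $i$ with $l_i\le l_j-2$. For an excess index $j$ of $l$, let $i$ be the last index with $l_i\le l_j-2$, and let $\mathrm{bal}[l,j]$ be the path-length sequence obtained from $l$ by replacing the entry $l_i$ at position $i$ with two consecutive entries equal to $l_i+1$ and replacing the two entries at positions $j,j+1$ (the first two occurrences of the value $l_j$) with a single entry equal to $l_j-1$. **Proposition 2.** Let $l$ be a path-length sequence that has an excess index, and let $j$ be its first excess index. Then $l$ is join-irreducible if and only if $\mathrm{bal}[l,k]\trianglelefteq\mathrm{bal}[l,j]$ for every excess index $k$ of $l$. -/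

import Mathlib

/-- A path-length sequence with `n` components: a weakly increasing sequence of non-negative
integers `l` with `∑ 2 ^ (-l i) = 1`.  Components are indexed by `Fin n`, that is, from `0`. -/
@[ext]
structure PathLengthSeq (n : ℕ) where
  /-- the components -/
  len : Fin n → ℕ
  mono : Monotone len
  kraft : ∑ i, ((2 : ℝ) ^ len i)⁻¹ = 1

namespace PathLengthSeq

variable {n : ℕ}

/-- The partial sum `2 ^ (-l 0) + ... + 2 ^ (-l m)`. -/
noncomputable def partialSum (l : PathLengthSeq n) (m : Fin n) : ℝ :=
  ∑ i ∈ Finset.Iic m, ((2 : ℝ) ^ l.len i)⁻¹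

theorem partialSum_injective :
    Function.Injective (partialSum : PathLengthSeq n → Fin n → ℝ) := by
  intro l h hlh
  have key : ∀ k : ℕ, ∀ m : Fin n, m.val = k → l.len m = h.len m := by
    intro k
    induction k using Nat.strong_induction_on with
    | _ k ih =>
      intro m hm
      have hsum : l.partialSum m = h.partialSum m := congrFun hlh m
      unfold partialSum at hsum
      rw [← Finset.Iio_insert, Finset.sum_insert (by simp), Finset.sum_insert (by simp)] at hsum
      have hlow : ∑ i ∈ Finset.Iio m, ((2 : ℝ) ^ l.len i)⁻¹
          = ∑ i ∈ Finset.Iio m, ((2 : ℝ) ^ h.len i)⁻¹ := by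
        refine Finset.sum_congr rfl fun i hi => ?_
        have him : i < m := Finset.mem_Iio.mp hi
        rw [ih i.val (by omega) i rfl]
      rw [hlow] at hsum
      exact pow_right_injective₀ (by norm_num : (0 : ℝ) < 2) (by norm_num)
        (inv_injective (add_right_cancel hsum))
  exact PathLengthSeq.ext (funext fun m => key m.val m rfl)

/-- The imbalance order: `l ≤ h` (`l` is more balanced than `h`) if every partial sum of `l` is
at most the corresponding partial sum of `h`. -/
noncomputable instance : PartialOrder (PathLengthSeq n) :=
  PartialOrder.lift partialSum partialSum_injective

theorem le_def (l h : PathLengthSeq n) :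
    l ≤ h ↔ ∀ m, l.partialSum m ≤ h.partialSum m := Iff.rfl

/-- `j` is an excess index of `l`: it is neither the first nor the last index,
`l (j - 1) < l j = l (j + 1)`, and there is an index `i` with `l i ≤ l j - 2`. -/
def IsExcess (l : PathLengthSeq n) (j : Fin n) : Prop :=
  ∃ (_ : 0 < j.val) (h : j.val + 1 < n),
    l.len ⟨j.val - 1, by omega⟩ < l.len j ∧ l.len j = l.len ⟨j.val + 1, h⟩ ∧
      ∃ i, l.len i + 2 ≤ l.len j

theorem IsExcess.nonempty {l : PathLengthSeq n} {j : Fin n} (hj : l.IsExcess j) :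
    (Finset.univ.filter fun i => l.len i + 2 ≤ l.len j).Nonempty := by
  obtain ⟨_, _, _, _, i, hi⟩ := hj
  exact ⟨i, by simpa using hi⟩

/-- The last index `i` such that `l i ≤ l j - 2`. -/
def donor (l : PathLengthSeq n) (j : Fin n) (hj : l.IsExcess j) : Fin n :=
  (Finset.univ.filter fun i => l.len i + 2 ≤ l.len j).max' hj.nonempty

/-- The components of `bal[l, j]`, where `i` is the last index with `l i ≤ l j - 2`: the entry at
`i` is replaced by two entries `l i + 1`, the entries strictly between `i` and `j` move one place
to the right, and the two entries at `j` and `j + 1` are replaced by one entry `l j - 1`. -/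
def balLen (l : PathLengthSeq n) (j : Fin n) (hj : l.IsExcess j) (p : Fin n) : ℕ :=
  let i := l.donor j hj
  if p < i then l.len p
  else if p.val ≤ i.val + 1 then l.len i + 1
  else if p ≤ j then l.len ⟨p.val - 1, by omega⟩
  else if p.val = j.val + 1 then l.len j - 1
  else l.len p

theorem donor_spec (l : PathLengthSeq n) (j : Fin n) (hj : l.IsExcess j) :
    l.len (l.donor j hj) + 2 ≤ l.len j := by
  exact (Finset.mem_filter.mp (Finset.max'_mem _ hj.nonempty)).2

theorem le_donor (l : PathLengthSeq n) (j : Fin n) (hj : l.IsExcess j) (p : Fin n)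
    (hp : l.len p + 2 ≤ l.len j) : p ≤ l.donor j hj :=
  Finset.le_max' _ _ (by simpa using hp)

theorem donor_lt (l : PathLengthSeq n) (j : Fin n) (hj : l.IsExcess j) :
    l.donor j hj < j := by
  by_contra h
  have h1 := l.mono (not_lt.mp h)
  have h2 := l.donor_spec j hj
  omega

theorem balLen_mono (l : PathLengthSeq n) (j : Fin n) (hj : l.IsExcess j) :
    Monotone (l.balLen j hj) := by
  intro p q hpq
  have hspec := l.donor_spec j hj
  have hlt := l.donor_lt j hj
  have hmax : ∀ r : Fin n, l.donor j hj < r → l.len j ≤ l.len r + 1 := by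
    intro r hr
    by_contra hc
    exact absurd (l.le_donor j hj r (by omega)) (not_le.mpr hr)
  obtain ⟨hj0, hj1, hja, hjb, -⟩ := id hj
  have hbelow : ∀ r : Fin n, r < j → l.len r + 1 ≤ l.len j := by
    intro r hr
    have := l.mono (show r ≤ ⟨j.val - 1, by omega⟩ from Fin.le_def.mpr (by simp; omega))
    omega
  have hpq' := l.mono hpq
  have hp1 : ∀ h : p.val - 1 < n, ∀ h' : q.val - 1 < n,
      l.len ⟨p.val - 1, h⟩ ≤ l.len ⟨q.val - 1, h'⟩ := fun h h' =>
    l.mono (Fin.le_def.mpr (by simp; omega))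
  have hpi : p < l.donor j hj → l.len p ≤ l.len (l.donor j hj) := fun h => l.mono h.le
  have hjq : j ≤ q → l.len j ≤ l.len q := fun h => l.mono h
  have hqi : ∀ h : q.val - 1 < n, l.donor j hj < ⟨q.val - 1, h⟩ →
      l.len j ≤ l.len ⟨q.val - 1, h⟩ + 1 := fun h => hmax _
  have hpj : ∀ h : p.val - 1 < n, (⟨p.val - 1, h⟩ : Fin n) < j →
      l.len ⟨p.val - 1, h⟩ + 1 ≤ l.len j := fun h => hbelow _
  have a1 := hpi
  have a2 := hp1 (by omega) (by omega)
  have a3 := hqi (by omega)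
  have a4 := hpj (by omega)
  simp only [Fin.lt_def, Fin.le_def] at *
  unfold balLen
  simp only [Fin.lt_def, Fin.le_def]
  split_ifs <;> omega

theorem sum_bal_aux (a b : ℕ → ℝ) (i j : ℕ) (hij : i < j)
    (h0 : ∀ p < i, b p = a p) (h1 : b i = a i / 2) (h2 : b (i + 1) = a i / 2)
    (h3 : ∀ p, i + 1 < p → p ≤ j → b p = a (p - 1)) (h4 : b (j + 1) = a j + a (j + 1))
    (h5 : ∀ p, j + 1 < p → b p = a p) (m : ℕ) (hm : j + 1 < m) :
    ∑ p ∈ Finset.range m, b p = ∑ p ∈ Finset.range m, a p := by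
  have key : ∀ m, ∑ p ∈ Finset.range m, b p = ∑ p ∈ Finset.range m, a p -
      (if m ≤ i then 0 else if m = i + 1 then a i / 2 else if m ≤ j + 1 then a (m - 1)
        else 0) := by
    intro m
    induction m with
    | zero => simp
    | succ m ih =>
      rw [Finset.sum_range_succ, Finset.sum_range_succ, ih]
      rcases lt_trichotomy m i with h | h | h
      · rw [h0 m h, if_pos (by omega), if_pos (by omega)]; ring
      · subst h
        rw [h1, if_pos (by omega), if_neg (by omega), if_pos rfl]; ring
      · rw [if_neg (by omega : ¬ m ≤ i), if_neg (by omega : ¬ m + 1 ≤ i),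
          if_neg (by omega : ¬ m + 1 = i + 1)]
        by_cases hmi : m = i + 1
        · subst hmi
          rw [h2, if_pos rfl, if_pos (by omega)]
          simp only [Nat.add_sub_cancel]; ring
        · rw [if_neg hmi]
          rcases lt_trichotomy m (j + 1) with h' | h' | h'
          · rw [h3 m (by omega) (by omega), if_pos (by omega), if_pos (by omega)]
            simp only [Nat.add_sub_cancel]; ring
          · subst h'
            rw [h4, if_pos le_rfl, if_neg (by omega)]
            simp only [Nat.add_sub_cancel]; ring
          · rw [h5 m h', if_neg (by omega), if_neg (by omega)]; ring
  rw [key m, if_neg (by omega), if_neg (by omega), if_neg (by omega), sub_zero]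

theorem balLen_kraft (l : PathLengthSeq n) (j : Fin n) (hj : l.IsExcess j) :
    ∑ p, ((2 : ℝ) ^ l.balLen j hj p)⁻¹ = 1 := by
  have hspec := l.donor_spec j hj
  have hlt : (l.donor j hj).val < j.val := l.donor_lt j hj
  obtain ⟨hj0, hj1, hja, hjb, -⟩ := id hj
  have hi : (l.donor j hj).val < n := (l.donor j hj).isLt
  have hs := sum_bal_aux (fun q => if h : q < n then ((2 : ℝ) ^ l.len ⟨q, h⟩)⁻¹ else 0)
    (fun q => if h : q < n then ((2 : ℝ) ^ l.balLen j hj ⟨q, h⟩)⁻¹ else 0)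
    (l.donor j hj).val j.val hlt ?_ ?_ ?_ ?_ ?_ ?_ n hj1
  · rw [Finset.sum_range, Finset.sum_range] at hs
    simpa [l.kraft] using hs
  · intro p hp
    simp [balLen, Fin.lt_def, hp]
  · simp [balLen, hi, pow_succ]; ring
  · have : (l.donor j hj).val + 1 < n := by omega
    simp [balLen, this, Fin.lt_def, pow_succ]; ring
  · intro p hp hpj
    have e1 : p < n := by omega
    have e2 : p - 1 < n := by omega
    simp only [e1, e2, dif_pos, balLen, Fin.lt_def, Fin.le_def]
    rw [if_neg (by omega), if_neg (by omega), if_pos hpj]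
  · simp only [hj1, dif_pos, j.isLt, balLen, Fin.lt_def, Fin.le_def]
    rw [if_neg (by omega), if_neg (by omega), if_neg (by omega), if_pos trivial, ← hjb]
    obtain ⟨c, hc⟩ : ∃ c, l.len j = c + 1 := ⟨l.len j - 1, by omega⟩
    simp only [Fin.eta, hc, Nat.add_sub_cancel, pow_succ]
    field_simp
    norm_num
  · intro p hp
    by_cases e1 : p < n
    · simp only [e1, dif_pos, balLen, Fin.lt_def, Fin.le_def]
      rw [if_neg (by omega), if_neg (by omega), if_neg (by omega), if_neg (by omega)]
    · simp [e1]

/-- The minimal balancing `bal[l, j]` of `l` at the excess index `j`. -/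
def bal (l : PathLengthSeq n) (j : Fin n) (hj : l.IsExcess j) : PathLengthSeq n where
  len := l.balLen j hj
  mono := l.balLen_mono j hj
  kraft := l.balLen_kraft j hj

/-- `l` is join-irreducible in the imbalance order: it covers exactly one path-length sequence
with the same number of components. -/
def JoinIrreducible (l : PathLengthSeq n) : Prop :=
  ∃! h : PathLengthSeq n, h ⋖ l

end PathLengthSeq

namespace PathLengthSeq

variable {n : ℕ}

/-! Every `bal[l, k]` lies strictly below `l`, and `exists_le_bal` shows that every `h < l` lies
below some `bal[l, k]`; hence the lower covers of `l` are the maximal balancings. By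
`le_of_bal_le_bal`, the balancing at the first excess index is itself maximal, so it is the only
cover exactly when it dominates all the others.

For `exists_le_bal`, follow the gap between the partial sums of `l` and `h` from its opening at `s`
to its closing at `r`. Dyadic divisibility forces `l` to repeat its value at `r - 1` and `r`, and
the first occurrence `k` of that value is an excess index. It also makes the gap at least the loss
caused by balancing at `k`. -/

theorem partialSum_zero (l : PathLengthSeq n) (h : 0 < n) :
    l.partialSum ⟨0, h⟩ = ((2 : ℝ) ^ l.len ⟨0, h⟩)⁻¹ := by
  have : Finset.Iic (⟨0, h⟩ : Fin n) = {⟨0, h⟩} := by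
    ext x; simp [Fin.le_def, Fin.ext_iff]
  simp [partialSum, this]

theorem partialSum_succ (l : PathLengthSeq n) (m : ℕ) (h : m + 1 < n) :
    l.partialSum ⟨m + 1, h⟩ =
      l.partialSum ⟨m, by omega⟩ + ((2 : ℝ) ^ l.len ⟨m + 1, h⟩)⁻¹ := by
  have : Finset.Iic (⟨m + 1, h⟩ : Fin n) =
      insert ⟨m + 1, h⟩ (Finset.Iic (⟨m, by omega⟩ : Fin n)) := by
    ext x; simp [Fin.le_def, Fin.ext_iff]; omega
  rw [partialSum, this, Finset.sum_insert (by simp), add_comm]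
  rfl

theorem partialSum_last (l : PathLengthSeq n) (m : Fin n) (h : m.val + 1 = n) :
    l.partialSum m = 1 := by
  have : Finset.Iic m = Finset.univ := by
    refine Finset.eq_univ_of_forall fun x => Finset.mem_Iic.mpr (Fin.le_def.mpr ?_)
    omega
  rw [partialSum, this, l.kraft]

/-! ### Dyadic divisibility of partial sums -/

theorem inv_two_pow_eq_mul {a b : ℕ} (h : a ≤ b) :
    ((2 : ℝ) ^ a)⁻¹ = ((2 : ℤ) ^ (b - a) : ℤ) * ((2 : ℝ) ^ b)⁻¹ := by
  obtain ⟨c, rfl⟩ := Nat.exists_eq_add_of_le h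
  push_cast
  rw [Nat.add_sub_cancel_left, pow_add]
  field_simp

theorem exists_partialSum_eq_mul (l : PathLengthSeq n) (m : Fin n) (c : ℕ) (hc : l.len m ≤ c) :
    ∃ z : ℤ, l.partialSum m = z * ((2 : ℝ) ^ c)⁻¹ := by
  refine ⟨∑ i ∈ Finset.Iic m, 2 ^ (c - l.len i), ?_⟩
  rw [partialSum, Int.cast_sum, Finset.sum_mul]
  refine Finset.sum_congr rfl fun i hi => ?_
  exact inv_two_pow_eq_mul ((l.mono (Finset.mem_Iic.mp hi)).trans hc)

theorem exists_partialSum_sub_eq_mul (l h : PathLengthSeq n) (m : Fin n) (c : ℕ)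
    (hl : l.len m ≤ c) (hh : h.len m ≤ c) :
    ∃ z : ℤ, l.partialSum m - h.partialSum m = z * ((2 : ℝ) ^ c)⁻¹ := by
  obtain ⟨x, hx⟩ := l.exists_partialSum_eq_mul m c hl
  obtain ⟨y, hy⟩ := h.exists_partialSum_eq_mul m c hh
  exact ⟨x - y, by rw [hx, hy]; push_cast; ring⟩

/-- A positive difference of partial sums is at least the common dyadic unit. -/
theorem inv_two_pow_le_partialSum_sub (l h : PathLengthSeq n) (m : Fin n) (c : ℕ)
    (hl : l.len m ≤ c) (hh : h.len m ≤ c) (hpos : 0 < l.partialSum m - h.partialSum m) :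
    ((2 : ℝ) ^ c)⁻¹ ≤ l.partialSum m - h.partialSum m := by
  obtain ⟨z, hz⟩ := exists_partialSum_sub_eq_mul l h m c hl hh
  have hu : (0 : ℝ) < ((2 : ℝ) ^ c)⁻¹ := by positivity
  rw [hz] at hpos ⊢
  have hz0 : (0 : ℝ) < z := pos_of_mul_pos_left hpos hu.le
  have hz1 : (1 : ℝ) ≤ z := by exact_mod_cast (by exact_mod_cast hz0 : (0 : ℤ) < z)
  nlinarith

theorem inv_two_pow_le_inv_two_pow {a b : ℕ} (h : a ≤ b) :
    ((2 : ℝ) ^ b)⁻¹ ≤ ((2 : ℝ) ^ a)⁻¹ :=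
  inv_anti₀ (by positivity) (pow_le_pow_right₀ (by norm_num) h)

theorem lt_of_inv_two_pow_lt {a b : ℕ} (h : ((2 : ℝ) ^ b)⁻¹ < ((2 : ℝ) ^ a)⁻¹) : a < b := by
  by_contra hc
  exact absurd (inv_two_pow_le_inv_two_pow (not_lt.mp hc)) (not_le.mpr h)

theorem inv_two_pow_succ (a : ℕ) : ((2 : ℝ) ^ (a + 1))⁻¹ = ((2 : ℝ) ^ a)⁻¹ / 2 := by
  rw [pow_succ, mul_inv]; rfl

/-! ### Partial sums of a balancing -/

/-- The amount by which balancing at `j` lowers the partial sum at `m`. -/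
noncomputable def deficit (l : PathLengthSeq n) (j : Fin n) (hj : l.IsExcess j) (m : Fin n) : ℝ :=
  if m < l.donor j hj then 0
  else if m = l.donor j hj then ((2 : ℝ) ^ l.len m)⁻¹ / 2
  else if m ≤ j then ((2 : ℝ) ^ l.len m)⁻¹
  else 0

/-- Splitting the donor loses half its term; the shift then makes the sums lag by one entry, until
the merged entry at `j + 1` catches up. -/
theorem partialSum_bal (l : PathLengthSeq n) (j : Fin n) (hj : l.IsExcess j) (m : Fin n) :
    (l.bal j hj).partialSum m = l.partialSum m - l.deficit j hj m := by
  have hspec := l.donor_spec j hj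
  have hlt : (l.donor j hj).val < j.val := l.donor_lt j hj
  obtain ⟨hj0, hj1, hja, hjb, -⟩ := id hj
  obtain ⟨m, hm⟩ := m
  have hlen : ∀ p, (l.bal j hj).len p = l.balLen j hj p := fun _ => rfl
  generalize hi : l.donor j hj = i at *
  induction m with
  | zero =>
    rw [partialSum_zero, partialSum_zero, hlen]
    unfold balLen deficit
    simp only [hi, Fin.lt_def, Fin.le_def, Fin.ext_iff]
    rcases Nat.eq_zero_or_pos i.val with h | h
    · have : i = ⟨0, hm⟩ := Fin.ext h
      subst this
      simp [inv_two_pow_succ]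
      ring
    · simp [h]
  | succ m ih =>
    rw [partialSum_succ, partialSum_succ, ih, hlen]
    unfold balLen deficit
    simp only [hi, Fin.lt_def, Fin.le_def, Fin.ext_iff]
    rcases lt_trichotomy (m + 1) i.val with h | h | h
    · rw [if_pos (by omega), if_pos (by omega), if_pos (by omega)]; ring
    · have : i = ⟨m + 1, hm⟩ := Fin.ext h.symm
      subst this
      simp [inv_two_pow_succ]
      ring
    · rw [if_neg (by omega : ¬ m < i.val), if_neg (by omega : ¬ m + 1 < i.val),
        if_neg (by omega : ¬ m + 1 < i.val), if_neg (by omega : ¬ m + 1 = i.val)]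
      by_cases hmi : m = i.val
      · subst hmi
        rw [if_pos rfl, if_pos le_rfl, if_pos (by omega), inv_two_pow_succ]; ring
      · rw [if_neg hmi, if_neg (by omega : ¬ m + 1 ≤ i.val + 1)]
        rcases lt_trichotomy m j.val with h' | h' | h'
        · rw [if_pos (by omega), if_pos (by omega), if_pos (by omega)]
          simp only [Nat.add_sub_cancel]; ring
        · subst h'
          rw [if_pos le_rfl, if_neg (by omega), if_pos rfl, if_neg (by omega), ← hjb]
          obtain ⟨c, hc⟩ : ∃ c, l.len j = c + 1 := ⟨l.len j - 1, by omega⟩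
          simp only [Fin.eta, hc, Nat.add_sub_cancel, inv_two_pow_succ]
          ring
        · rw [if_neg (by omega), if_neg (by omega), if_neg (by omega), if_neg (by omega)]; ring

theorem deficit_nonneg (l : PathLengthSeq n) (j : Fin n) (hj : l.IsExcess j) (m : Fin n) :
    0 ≤ l.deficit j hj m := by
  unfold deficit
  split_ifs <;> positivity

theorem deficit_self_pos (l : PathLengthSeq n) (j : Fin n) (hj : l.IsExcess j) :
    0 < l.deficit j hj j := by
  have hlt := l.donor_lt j hj
  rw [deficit, if_neg hlt.not_gt, if_neg hlt.ne', if_pos le_rfl]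
  positivity

theorem deficit_eq_zero_of_lt (l : PathLengthSeq n) (j : Fin n) (hj : l.IsExcess j) {m : Fin n}
    (h : j < m) : l.deficit j hj m = 0 := by
  have hlt := (l.donor_lt j hj).trans h
  rw [deficit, if_neg hlt.not_gt, if_neg hlt.ne', if_neg h.not_ge]

theorem bal_lt (l : PathLengthSeq n) (j : Fin n) (hj : l.IsExcess j) : l.bal j hj < l := by
  refine lt_of_le_of_ne (fun m => ?_) fun h => ?_
  · change (l.bal j hj).partialSum m ≤ l.partialSum m
    rw [partialSum_bal]
    linarith [l.deficit_nonneg j hj m]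
  · have h1 := l.partialSum_bal j hj j
    rw [h] at h1
    linarith [l.deficit_self_pos j hj]

/-- Past `j` the balancing at `j` has the partial sums of `l`, whereas balancing at `k` strictly
lowers the sum at `k`. -/
theorem le_of_bal_le_bal (l : PathLengthSeq n) {j k : Fin n} (hj : l.IsExcess j)
    (hk : l.IsExcess k) (h : l.bal j hj ≤ l.bal k hk) : k ≤ j := by
  by_contra! hc
  have h1 := (le_def _ _).mp h k
  rw [partialSum_bal, partialSum_bal, l.deficit_eq_zero_of_lt j hj hc] at h1
  linarith [l.deficit_self_pos k hk]

/-! ### The gap between `l` and a smaller sequence -/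

/-- At the first differing index the gap is a difference of single terms, and the term of `h` is at
most half that of `l`. -/
theorem exists_first_partialSum_lt {h l : PathLengthSeq n} (hlt : h < l) :
    ∃ s : Fin n, h.partialSum s < l.partialSum s ∧ h.len s > l.len s ∧
      ((2 : ℝ) ^ l.len s)⁻¹ / 2 ≤ l.partialSum s - h.partialSum s := by
  have hle := (le_def _ _).mp hlt.le
  have hex : ∃ s : ℕ, ∃ hs : s < n, h.partialSum ⟨s, hs⟩ < l.partialSum ⟨s, hs⟩ := by
    by_contra! hc
    exact hlt.not_ge fun m => hc m.val m.isLt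
  classical
  obtain ⟨hs, hpos⟩ := Nat.find_spec hex
  have hmin := fun m => Nat.find_min (H := hex) (m := m)
  generalize Nat.find hex = s at *
  have hdiff : l.partialSum ⟨s, hs⟩ - h.partialSum ⟨s, hs⟩ =
      ((2 : ℝ) ^ l.len ⟨s, hs⟩)⁻¹ - ((2 : ℝ) ^ h.len ⟨s, hs⟩)⁻¹ := by
    cases s with
    | zero => rw [partialSum_zero, partialSum_zero]
    | succ s =>
      have h0 : l.partialSum ⟨s, by omega⟩ = h.partialSum ⟨s, by omega⟩ := by
        refine le_antisymm ?_ (hle _)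
        by_contra! hc
        exact hmin s (by omega) ⟨by omega, hc⟩
      rw [partialSum_succ, partialSum_succ, h0]; ring
  have hlen : l.len ⟨s, hs⟩ < h.len ⟨s, hs⟩ := lt_of_inv_two_pow_lt (by linarith)
  refine ⟨⟨s, hs⟩, hpos, hlen, ?_⟩
  have := inv_two_pow_le_inv_two_pow (Nat.succ_le_of_lt hlen)
  rw [Nat.succ_eq_add_one, inv_two_pow_succ] at this
  linarith

/-- After a first index `s`, the partial sums of `h < l` meet again at a first index `r`. -/
theorem exists_first_partialSum_eq (h l : PathLengthSeq n) (hle : h ≤ l) (s : Fin n)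
    (hs : h.partialSum s < l.partialSum s) :
    ∃ r : Fin n, s < r ∧ h.partialSum r = l.partialSum r ∧
      ∀ m, s ≤ m → m < r → h.partialSum m < l.partialSum m := by
  classical
  have hex : ∃ r : ℕ, ∃ hr : r < n, s.val < r ∧ h.partialSum ⟨r, hr⟩ = l.partialSum ⟨r, hr⟩ := by
    have hlast : s.val + 1 ≠ n := fun hc => by
      rw [partialSum_last _ _ hc, partialSum_last _ _ hc] at hs
      exact lt_irrefl _ hs
    have := s.isLt
    refine ⟨n - 1, by omega, by omega, ?_⟩
    rw [partialSum_last _ _ (by simp; omega), partialSum_last _ _ (by simp; omega)]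
  obtain ⟨hr, hsr, heq⟩ := Nat.find_spec hex
  have hmin := fun m => Nat.find_min (H := hex) (m := m)
  refine ⟨⟨Nat.find hex, hr⟩, hsr, heq, fun m hsm hmr => ?_⟩
  rcases hsm.eq_or_lt with rfl | hsm
  · exact hs
  · exact lt_of_le_of_ne ((le_def _ _).mp hle m) fun hc => hmin m.val hmr ⟨m.isLt, hsm, hc⟩

/-- If the new entry of `h` is the longer one, the old gap is at least its term, so adding the new
terms leaves at least the term of `l`. Otherwise the new gap is a positive multiple of that term. -/
theorem inv_two_pow_len_le_of_pred (h l : PathLengthSeq n) (m : ℕ) (hm : m + 1 < n)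
    (h0 : h.partialSum ⟨m, by omega⟩ < l.partialSum ⟨m, by omega⟩)
    (h1 : h.partialSum ⟨m + 1, hm⟩ < l.partialSum ⟨m + 1, hm⟩) :
    ((2 : ℝ) ^ l.len ⟨m + 1, hm⟩)⁻¹ ≤
      l.partialSum ⟨m + 1, hm⟩ - h.partialSum ⟨m + 1, hm⟩ := by
  rcases le_or_gt (h.len ⟨m + 1, hm⟩) (l.len ⟨m + 1, hm⟩) with hc | hc
  · exact inv_two_pow_le_partialSum_sub l h _ _ le_rfl hc (sub_pos.mpr h1)
  · have hle : (⟨m, by omega⟩ : Fin n) ≤ ⟨m + 1, hm⟩ := Fin.le_def.mpr (by simp)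
    have := inv_two_pow_le_partialSum_sub l h ⟨m, by omega⟩ (h.len ⟨m + 1, hm⟩)
      ((l.mono hle).trans hc.le) (h.mono hle) (sub_pos.mpr h0)
    rw [partialSum_succ, partialSum_succ]
    linarith

/-- A parity argument: were `l` to increase at `r + 1`, its new term would be half of a dyadic unit
dividing both the old gap and the new term of `h`, so the gap could not close. -/
theorem len_lt_of_partialSum_eq (h l : PathLengthSeq n) (r : ℕ) (hr : r + 1 < n)
    (h0 : h.partialSum ⟨r, by omega⟩ < l.partialSum ⟨r, by omega⟩)
    (h1 : h.partialSum ⟨r + 1, hr⟩ = l.partialSum ⟨r + 1, hr⟩) :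
    h.len ⟨r + 1, hr⟩ < l.len ⟨r + 1, hr⟩ ∧
      l.len ⟨r, by omega⟩ = l.len ⟨r + 1, hr⟩ := by
  rw [partialSum_succ, partialSum_succ] at h1
  have hlt : h.len ⟨r + 1, hr⟩ < l.len ⟨r + 1, hr⟩ := lt_of_inv_two_pow_lt (by linarith)
  refine ⟨hlt, ?_⟩
  have hle : (⟨r, by omega⟩ : Fin n) ≤ ⟨r + 1, hr⟩ := Fin.le_def.mpr (by simp)
  by_contra hne
  have hl := lt_of_le_of_ne (l.mono hle) hne
  have hh := h.mono hle
  obtain ⟨c, hc⟩ : ∃ c, l.len ⟨r + 1, hr⟩ = c + 1 := ⟨l.len ⟨r + 1, hr⟩ - 1, by omega⟩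
  obtain ⟨z, hz⟩ := exists_partialSum_sub_eq_mul l h ⟨r, by omega⟩ c (by omega) (by omega)
  have hb := inv_two_pow_eq_mul (show h.len ⟨r + 1, hr⟩ ≤ c by omega)
  rw [hc, inv_two_pow_succ, hb] at h1
  have hu : ((2 : ℝ) ^ c)⁻¹ ≠ 0 := by positivity
  generalize (2 : ℤ) ^ (c - h.len ⟨r + 1, hr⟩) = y at *
  have : (2 * (y - z) : ℝ) = 1 := by
    apply mul_right_cancel₀ hu
    linarith
  have : 2 * (y - z) = 1 := by exact_mod_cast this
  omega

/-- Every path-length sequence below `l` is below some minimal balancing of `l`. -/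
theorem exists_le_bal {h l : PathLengthSeq n} (hlt : h < l) :
    ∃ (k : Fin n) (hk : l.IsExcess k), h ≤ l.bal k hk := by
  classical
  obtain ⟨s, hs, hslen, hshalf⟩ := exists_first_partialSum_lt hlt
  obtain ⟨r, hsr, heq, hpos⟩ := exists_first_partialSum_eq h l hlt.le s hs
  have hsr' : s.val < r.val := hsr
  obtain ⟨r, hrn⟩ := r
  obtain ⟨r', rfl⟩ : ∃ r', r = r' + 1 := ⟨r - 1, by simp at hsr'; omega⟩
  obtain ⟨hrlen, hreq⟩ := len_lt_of_partialSum_eq h l r' (by omega)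
    (hpos _ (Fin.le_def.mpr (by simp at hsr'; simp; omega)) (Fin.lt_def.mpr (by simp))) heq
  have hhs := h.mono hsr.le
  -- The repeated value may start before `r'`; an excess index must be its first occurrence.
  have hex : ∃ k : ℕ, ∃ hk : k < n, l.len ⟨k, hk⟩ = l.len ⟨r' + 1, hrn⟩ :=
    ⟨r', by omega, hreq⟩
  obtain ⟨hkn, hklen⟩ := Nat.find_spec hex
  have hkr : Nat.find hex ≤ r' := Nat.find_min' hex ⟨by omega, hreq⟩
  have hmin := fun m => Nat.find_min (H := hex) (m := m)
  generalize Nat.find hex = k at *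
  -- `l.len s < h.len s ≤ h.len r < l.len r`, where `r = r' + 1`. The two strict steps also supply
  -- the difference of 2 required for an excess index.
  have hsk : s.val < k := by
    by_contra! hc
    have := l.mono (show (⟨k, hkn⟩ : Fin n) ≤ s from hc)
    omega
  have hk : l.IsExcess ⟨k, hkn⟩ := by
    refine ⟨by simp; omega, by simp; omega, ?_, ?_, s, by omega⟩
    · refine lt_of_le_of_ne (l.mono (Fin.le_def.mpr (by simp))) fun hc => ?_
      exact hmin (k - 1) (by omega) ⟨by omega, hc.trans hklen⟩
    · refine le_antisymm (l.mono (Fin.le_def.mpr (by simp))) ?_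
      rw [hklen]
      exact l.mono (Fin.le_def.mpr (by simp; omega))
  have hsd : s ≤ l.donor _ hk := l.le_donor _ hk s (by omega)
  have hafter : ∀ m : Fin n, s < m → m.val ≤ r' →
      ((2 : ℝ) ^ l.len m)⁻¹ ≤ l.partialSum m - h.partialSum m := by
    rintro ⟨m, hm⟩ hsm hmr
    obtain ⟨m, rfl⟩ : ∃ m', m = m' + 1 := ⟨m - 1, by have : s.val < m := hsm; omega⟩
    simp only [Fin.lt_def] at hsm hmr
    exact inv_two_pow_len_le_of_pred h l m hm
      (hpos _ (Fin.le_def.mpr (by simp; omega)) (Fin.lt_def.mpr (by simp; omega)))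
      (hpos _ (Fin.le_def.mpr (by simp; omega)) (Fin.lt_def.mpr (by simp; omega)))
  refine ⟨⟨k, hkn⟩, hk, fun m => ?_⟩
  change h.partialSum m ≤ (l.bal _ hk).partialSum m
  rw [partialSum_bal]
  suffices l.deficit _ hk m ≤ l.partialSum m - h.partialSum m by linarith
  have hnonneg : 0 ≤ l.partialSum m - h.partialSum m :=
    sub_nonneg.mpr ((le_def _ _).mp hlt.le m)
  have hdk : l.donor _ hk < ⟨k, hkn⟩ := l.donor_lt _ hk
  unfold deficit
  split_ifs with h1 h2 h3
  · exact hnonneg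
  -- The donor loses only half a term, which the gap covers even when the donor is `s` itself.
  · rcases (h2 ▸ hsd : s ≤ m).eq_or_lt with rfl | hsm
    · exact hshalf
    · have hmk : m.val < k := by rw [h2]; exact hdk
      have := hafter m hsm (by omega)
      have : (0 : ℝ) < ((2 : ℝ) ^ l.len m)⁻¹ := by positivity
      linarith
  · have hdm : l.donor _ hk < m := lt_of_le_of_ne (not_lt.mp h1) (Ne.symm h2)
    exact hafter m (hsd.trans_lt hdm) (le_trans (Fin.le_def.mp h3) hkr)
  · exact hnonneg

/-! ### Lower covers -/

/-- Take a maximal balancing above the given one: anything strictly between it and `l` would lie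
below another balancing, against maximality. -/
theorem exists_bal_covBy_ge (l : PathLengthSeq n) (k : Fin n) (hk : l.IsExcess k) :
    ∃ (k' : Fin n) (hk' : l.IsExcess k'), l.bal k hk ≤ l.bal k' hk' ∧ l.bal k' hk' ⋖ l := by
  obtain ⟨_, hle, ⟨⟨k', hk'⟩, rfl⟩, hmax⟩ :=
    (Set.finite_range fun x : {k : Fin n // l.IsExcess k} => l.bal x.1 x.2).exists_le_maximal
      ⟨⟨k, hk⟩, rfl⟩
  refine ⟨k', hk', hle, l.bal_lt k' hk', fun c hc hcl => ?_⟩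
  obtain ⟨p, hp, hcp⟩ := exists_le_bal hcl
  exact (hc.trans_le hcp).not_ge (hmax ⟨⟨p, hp⟩, rfl⟩ (hc.le.trans hcp))

end PathLengthSeq

theorem proposition2 {n : ℕ} (l : PathLengthSeq n) (j : Fin n)
    (hj : IsLeast {k : Fin n | l.IsExcess k} j) :
    l.JoinIrreducible ↔
      ∀ (k : Fin n) (hk : l.IsExcess k), l.bal k hk ≤ l.bal j hj.1 := by
  constructor
  · rintro ⟨c, -, huniq⟩ k hk
    obtain ⟨p, hp, hjp, hpc⟩ := l.exists_bal_covBy_ge j hj.1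
    obtain ⟨q, hq, hkq, hqc⟩ := l.exists_bal_covBy_ge k hk
    -- A balancing above the one at `j` has index at most `j`, hence equal to `j` by minimality; so
    -- `bal[l, j]` is itself a cover.
    obtain rfl : p = j := le_antisymm (l.le_of_bal_le_bal hj.1 hp hjp) (hj.2 hp)
    rwa [(huniq _ hqc).trans (huniq _ hpc).symm] at hkq
  · intro hall
    have hbelow : ∀ h, h < l → h ≤ l.bal j hj.1 := fun h hlt => by
      obtain ⟨k, hk, hle⟩ := PathLengthSeq.exists_le_bal hlt
      exact hle.trans (hall k hk)
    refine ⟨l.bal j hj.1, ⟨l.bal_lt j hj.1, fun c hc hcl => hc.not_ge (hbelow c hcl)⟩, ?_⟩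
    intro h hcov
    exact (hbelow h hcov.lt).eq_of_not_lt fun hlt => hcov.2 hlt (l.bal_lt j hj.1)
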